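/- All vector lattices are real and Archimedean. Let $X$ be a vector lattice, let $(E,\tau)$ be a Hausdorff locally solid vector lattice (a vector lattice with a Hausdorff linear topology that has a base at zero consisting of solid sets), and let $p\colon X\to E_+$ be a monotone vector norm, that is, $p(x)=0\Leftrightarrow x=0$, $p(\lambda x)=|\lambda|p(x)$, $p(x+y)\le p(x)+p(y)$, and $|x|\le|y|$ implies $p(x)\le p(y)$; such a triple $(X,p,E_\tau)$ is called a lattice-normed locally solid vector lattice (LNLS). A net $(x_\alpha)$ in $X$ is said to $up_\tau$-converge to $x$ in $(X,p,E_\tau)$ if $p(|x_\alpha-x|\wedge u)\xrightarrow{\tau}0$ for every $u\in X_+$. Let $\tilde X$ be the order (Dedekind) completion of $X$, that is, an order complete vector lattice that contains $X$ as a vector sublattice and in which every element is the supremum of the elements of $X$ below it and the infimum of the elements of $X$ above it. Suppose that $(\tilde X,p,E_\tau)$ is an LNLS whose norm extends the norm $p$ of $X$. Then $X$ is majorizing in $\tilde X$ (every element of $\tilde X$ lies below some element of $X$), and every net $(x_\alpha)$ in $X$ that $up_\tau$-converges to $0$ in $(X,p,E_\tau)$ also $up_\tau$-converges to $0$ in $(\tilde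 X,p,E_\tau)$. -/

import Mathlib

open Filter Topology

/-- The Archimedean property of a vector lattice: if the multiples `n • x` are bounded above
by one element, then `x ≤ 0`. (Mathlib's `Archimedean` is a different, much stronger property,
which makes every strictly positive element an order unit.) -/
class ArchimedeanRiesz (X : Type*) [AddCommGroup X] [Lattice X] : Prop where
  nonpos_of_nsmul_le : ∀ x y : X, (∀ n : ℕ, n • x ≤ y) → x ≤ 0

/-- The topology of `E` has a base at zero consisting of solid sets. -/
class LocallySolid (E : Type*) [AddCommGroup E] [Lattice E] [TopologicalSpace E] : Prop where
  hasBasis_solid : (𝓝 (0 : E)).HasBasis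
    (fun s : Set E => s ∈ 𝓝 (0 : E) ∧ LatticeOrderedAddCommGroup.IsSolid s) id

/-- `p` is a monotone `E`-valued vector norm on the vector lattice `X`, that is, `(X, p, E)` is
a lattice-normed vector lattice. -/
structure IsLatticeNorm {X E : Type*} [AddCommGroup X] [Lattice X] [Module ℝ X]
    [AddCommGroup E] [Lattice E] [Module ℝ E] (p : X → E) : Prop where
  nonneg : ∀ x, 0 ≤ p x
  eq_zero_iff : ∀ x, p x = 0 ↔ x = 0
  map_smul : ∀ (r : ℝ) (x : X), p (r • x) = |r| • p x
  add_le : ∀ x y, p (x + y) ≤ p x + p y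
  mono : ∀ x y, |x| ≤ |y| → p x ≤ p y

/-- Unbounded `p_τ`-convergence of the net `x` to `x₀`. -/
def UpTauTendsto {X E A : Type*} [AddCommGroup X] [Lattice X] [AddCommGroup E]
    [TopologicalSpace E] [Preorder A] (p : X → E) (x : A → X) (x₀ : X) : Prop :=
  ∀ u : X, 0 ≤ u → Tendsto (fun a => p (|x a - x₀| ⊓ u)) atTop (𝓝 0)

/-- The vector lattice `Y`, together with the embedding `ι` of `X`, is an order (Dedekind)
completion of the vector lattice `X`: `ι` is an injective lattice homomorphism, `Y` is order
complete, and every element of `Y` is the supremum of the elements of `X` below it and the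
infimum of the elements of `X` above it. -/
structure IsOrderCompletion {X Y : Type*} [AddCommGroup X] [Lattice X] [Module ℝ X]
    [AddCommGroup Y] [Lattice Y] [Module ℝ Y] (ι : X →ₗ[ℝ] Y) : Prop where
  injective : Function.Injective ι
  map_sup : ∀ a b, ι (a ⊔ b) = ι a ⊔ ι b
  map_inf : ∀ a b, ι (a ⊓ b) = ι a ⊓ ι b
  exists_isLUB : ∀ s : Set Y, s.Nonempty → BddAbove s → ∃ y, IsLUB s y
  isLUB_below : ∀ y : Y, IsLUB (ι '' {x | ι x ≤ y}) y
  isGLB_above : ∀ y : Y, IsGLB (ι '' {x | y ≤ ι x}) y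

/-- `X` is majorizing in `Y`, where `X` is regarded as a part of `Y` through `ι`. -/
def IsMajorizing {X Y : Type*} [LE Y] (ι : X → Y) : Prop :=
  ∀ y : Y, ∃ x : X, y ≤ ι x

/-!
If some `y : Y` lay below no element of `X`, it would be the infimum of the empty set, that is, the
greatest element of the ordered group `Y`, which is impossible unless `Y` is trivial. So every
`u : Y` lies below some `w : X` with `0 ≤ w`, and the test element `u` may be replaced by `w`:
`|x a| ⊓ u ≤ |x a| ⊓ w`, the right-hand side lies in `X`, and solidity of the neighbourhoods of zero
turns this domination into convergence.
-/

theorem IsMajorizing.of_isGLB {X Y : Type*} [Nonempty X] [AddGroup Y] [Preorder Y]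
    [AddLeftMono Y] {ι : X → Y} (hι : ∀ y, IsGLB (ι '' {x | y ≤ ι x}) y) : IsMajorizing ι := by
  intro y
  by_contra! h_none_above
  have h_top : IsTop y := by
    simpa [h_none_above] using hι y
  obtain ⟨x₀⟩ := ‹Nonempty X›
  have h_le : y + (-ι x₀ + y) ≤ y := h_top _
  exact h_none_above x₀ (by simpa using h_le)

theorem IsMajorizing.exists_nonneg {X Y : Type*} [SemilatticeSup X] [Zero X] [Preorder Y]
    {ι : X → Y} (hι : IsMajorizing ι) (hmono : Monotone ι) (y : Y) : ∃ x, 0 ≤ x ∧ y ≤ ι x := by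
  obtain ⟨x, hyx⟩ := hι y
  exact ⟨x ⊔ 0, le_sup_right, hyx.trans (hmono le_sup_left)⟩

theorem LocallySolid.tendsto_zero_of_abs_le {E A : Type*} [AddCommGroup E] [Lattice E]
    [TopologicalSpace E] [LocallySolid E] {l : Filter A} {f g : A → E}
    (hg : Tendsto g l (𝓝 0)) (hfg : ∀ᶠ a in l, |f a| ≤ |g a|) : Tendsto f l (𝓝 0) := by
  rw [LocallySolid.hasBasis_solid.tendsto_right_iff]
  rintro s ⟨hs, hs_solid⟩
  filter_upwards [hg hs, hfg] with a hga hle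
  exact hs_solid hga hle

theorem map_abs_of_map_sup {X Y : Type*} [AddGroup X] [Lattice X] [AddGroup Y] [Lattice Y]
    (ι : X →+ Y) (hsup : ∀ a b, ι (a ⊔ b) = ι a ⊔ ι b) (a : X) : ι |a| = |ι a| := by
  simp only [abs, hsup, map_neg]

section Transfer

variable {X Y E A : Type*} [AddCommGroup X] [Lattice X]
  [AddCommGroup Y] [Lattice Y] [IsOrderedAddMonoid Y]
  [AddCommGroup E] [Lattice E] [IsOrderedAddMonoid E] [TopologicalSpace E] [LocallySolid E]
  [Preorder A] {ι : X →+ Y} {p : X → E} {q : Y → E} {x : A → X} {x₀ : X}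

theorem UpTauTendsto.map_of_isMajorizing (hx : UpTauTendsto p x x₀) (hι : IsMajorizing ι)
    (hsup : ∀ a b, ι (a ⊔ b) = ι a ⊔ ι b) (hinf : ∀ a b, ι (a ⊓ b) = ι a ⊓ ι b)
    (hq_nonneg : ∀ y, 0 ≤ q y) (hq_mono : ∀ y z, |y| ≤ |z| → q y ≤ q z)
    (hqp : ∀ v, q (ι v) = p v) :
    UpTauTendsto q (fun a => ι (x a)) (ι x₀) := by
  intro u hu
  have hι_mono : Monotone ι := .of_map_sup hsup
  obtain ⟨w, hw, huw⟩ := hι.exists_nonneg hι_mono u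
  refine LocallySolid.tendsto_zero_of_abs_le (hx w hw) (Eventually.of_forall fun a => ?_)
  have h_inf_nonneg : 0 ≤ |ι (x a) - ι x₀| ⊓ u := le_inf (abs_nonneg _) hu
  have h_inf_le : |ι (x a) - ι x₀| ⊓ u ≤ ι (|x a - x₀| ⊓ w) := by
    rw [hinf, map_abs_of_map_sup ι hsup, map_sub]
    exact inf_le_inf_left _ huw
  have h_norm_le : q (|ι (x a) - ι x₀| ⊓ u) ≤ p (|x a - x₀| ⊓ w) :=
    (hq_mono _ _ (abs_le_abs_of_nonneg h_inf_nonneg h_inf_le)).trans_eq (hqp _)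
  exact abs_le_abs_of_nonneg (hq_nonneg _) h_norm_le

theorem mainTheorem10_general (hglb : ∀ y, IsGLB (ι '' {v | y ≤ ι v}) y)
    (hsup : ∀ a b, ι (a ⊔ b) = ι a ⊔ ι b) (hinf : ∀ a b, ι (a ⊓ b) = ι a ⊓ ι b)
    (hq_nonneg : ∀ y, 0 ≤ q y) (hq_mono : ∀ y z, |y| ≤ |z| → q y ≤ q z)
    (hqp : ∀ v, q (ι v) = p v) (hx : UpTauTendsto p x x₀) :
    IsMajorizing ι ∧ UpTauTendsto q (fun a => ι (x a)) (ι x₀) :=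
  have hmaj : IsMajorizing ι := .of_isGLB hglb
  ⟨hmaj, hx.map_of_isMajorizing hmaj hsup hinf hq_nonneg hq_mono hqp⟩

end Transfer

theorem mainTheorem10
    {X Y E A : Type*}
    -- the vector lattice `X`
    [AddCommGroup X] [Lattice X] [IsOrderedAddMonoid X] [Module ℝ X] [IsOrderedModule ℝ X]
    [ArchimedeanRiesz X]
    -- the Hausdorff locally solid vector lattice `E`
    [AddCommGroup E] [Lattice E] [IsOrderedAddMonoid E] [Module ℝ E] [IsOrderedModule ℝ E]
    [ArchimedeanRiesz E]
    [TopologicalSpace E] [IsTopologicalAddGroup E] [ContinuousSMul ℝ E] [T2Space E]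
    [LocallySolid E]
    -- the order completion `Y` of `X`
    [AddCommGroup Y] [Lattice Y] [IsOrderedAddMonoid Y] [Module ℝ Y] [IsOrderedModule ℝ Y]
    (ι : X →ₗ[ℝ] Y) (hι : IsOrderCompletion ι)
    -- the lattice norm of `X`, and the one of `Y` which extends it
    (p : X → E) (hp : IsLatticeNorm p)
    (q : Y → E) (hq : IsLatticeNorm q) (hqp : ∀ x, q (ι x) = p x)
    -- the net
    [Preorder A] [IsDirectedOrder A] [Nonempty A] (x : A → X)
    (hx : UpTauTendsto p x 0) :
    IsMajorizing ι ∧ UpTauTendsto q (fun a => ι (x a)) 0 := by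
  simpa using mainTheorem10_general (ι := ι.toAddMonoidHom) hι.isGLB_above hι.map_sup hι.map_inf
    hq.nonneg hq.mono hqp hx
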